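/- Let $(I,\mathscr I,\nu)$ be a probability space and let $\{C_i\}_{i\in I}$ be a family of non-empty closed convex subsets of $\mathbb R^k$ (with the Euclidean norm) such that, for every $x\in\mathbb R^k$, the map $i\mapsto P_{C_i}(x)$ is measurable, where $P_{C_i}$ denotes the metric projection onto $C_i$. Assume that $$C^\ast=\{x\in\mathbb R^k : x\in C_i \text{ for } \nu\text{-almost every } i\}$$ is non-empty, and let $\alpha\in(0,2)$. Let $(\xi_n)_{n\ge 0}$ be an ergodic stationary sequence of $I$-valued random variables with distribution $\nu$, defined on a probability space $(W,\mathscr A,\mathbf P)$; that is, each $\xi_n$ has law $\nu$, and the shift $(\omega_n)_{n\ge0}\mapsto(\omega_{n+1})_{n\ge0}$ on $I^{\mathbb N}$ preserves, and is ergodic for, the law of $(\xi_n)_{n\ge0}$. Then for every initial point $x_0\in\mathbb R^k$ the sequence defined by $$X_0=x_0,\qquad X_{n+1}=X_n+\alpha\bigl(P_{C_{\xi_n}}(X_n)-X_n\bigr)\quad (n\ge0)$$ consists of random variables (measurable maps $W\to\mathbb R^k$), and there is a random variable $X\colon W\to\mathbb R^k$ with values in $C^\ast$ such that $X_n\to X$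 almost surely. -/

import Mathlib

open MeasureTheory Filter Topology

/-- Metric projection onto `C`: a point of `C` at minimal distance from `x`. For a non-empty
closed convex subset of a Euclidean space this point exists and is unique (see `metricProj_mem`,
`dist_metricProj_le` and `eq_metricProj` below). -/
noncomputable def metricProj {k : ℕ} (C : Set (EuclideanSpace ℝ (Fin k)))
    (x : EuclideanSpace ℝ (Fin k)) : EuclideanSpace ℝ (Fin k) :=
  Classical.epsilon fun p => p ∈ C ∧ ∀ y ∈ C, dist x p ≤ dist x y

theorem metricProj_spec {k : ℕ} {C : Set (EuclideanSpace ℝ (Fin k))} (hne : C.Nonempty)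
    (hcl : IsClosed C) (x : EuclideanSpace ℝ (Fin k)) :
    metricProj C x ∈ C ∧ ∀ y ∈ C, dist x (metricProj C x) ≤ dist x y := by
  refine Classical.epsilon_spec (p := fun p => p ∈ C ∧ ∀ y ∈ C, dist x p ≤ dist x y) ?_
  obtain ⟨p, hp, h⟩ := hcl.exists_infDist_eq_dist hne x
  exact ⟨p, hp, fun y hy => h ▸ Metric.infDist_le_dist_of_mem hy⟩

theorem metricProj_mem {k : ℕ} {C : Set (EuclideanSpace ℝ (Fin k))} (hne : C.Nonempty)
    (hcl : IsClosed C) (x : EuclideanSpace ℝ (Fin k)) : metricProj C x ∈ C :=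
  (metricProj_spec hne hcl x).1

theorem dist_metricProj_le {k : ℕ} {C : Set (EuclideanSpace ℝ (Fin k))} (hne : C.Nonempty)
    (hcl : IsClosed C) (x : EuclideanSpace ℝ (Fin k)) {y : EuclideanSpace ℝ (Fin k)}
    (hy : y ∈ C) : dist x (metricProj C x) ≤ dist x y :=
  (metricProj_spec hne hcl x).2 y hy

theorem eq_metricProj {k : ℕ} {C : Set (EuclideanSpace ℝ (Fin k))}
    (hcl : IsClosed C) (hcv : Convex ℝ C) (x : EuclideanSpace ℝ (Fin k))
    {p : EuclideanSpace ℝ (Fin k)} (hp : p ∈ C) (hmin : ∀ y ∈ C, dist x p ≤ dist x y) :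
    p = metricProj C x := by
  have hne : C.Nonempty := ⟨p, hp⟩
  obtain ⟨hq, hqmin⟩ := metricProj_spec hne hcl x
  set q := metricProj C x
  have heq : dist x p = dist x q := le_antisymm (hmin q hq) (hqmin p hp)
  have hmid : midpoint ℝ p q ∈ C := hcv.midpoint_mem hp hq
  have h1 := hmin _ hmid
  have h2 := EuclideanGeometry.dist_sq_add_dist_sq_eq_two_mul_dist_midpoint_sq_add_half_dist_sq
    x p q
  have h3 : dist p q = 0 := by
    have h4 : dist x p ^ 2 ≤ dist x (midpoint ℝ p q) ^ 2 := by gcongr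
    rw [← heq] at h2
    nlinarith [sq_nonneg (dist p q)]
  exact dist_eq_zero.mp h3

/-- `(ξ n)` is an ergodic stationary sequence of random variables: the left shift preserves
the law of the path `(ξ 0, ξ 1, …)` on `I^ℕ` (product σ-algebra) and is ergodic for it. -/
structure IsErgodicStationary {W I : Type*} [MeasurableSpace W] [MeasurableSpace I]
    (P : Measure W) (ξ : ℕ → W → I) : Prop where
  measurable : ∀ n, Measurable (ξ n)
  ergodic : Ergodic (fun (ω : ℕ → I) (n : ℕ) => ω (n + 1))
    (P.map (fun (w : W) (n : ℕ) => ξ n w))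

/-- The set `C*` of points lying in `C i` for `ν`-almost every `i`. -/
def aeInter {k : ℕ} {I : Type*} [MeasurableSpace I] (ν : Measure I)
    (C : I → Set (EuclideanSpace ℝ (Fin k))) : Set (EuclideanSpace ℝ (Fin k)) :=
  {x | ∀ᵐ i ∂ν, x ∈ C i}

/-- The randomized projection iteration with relaxation parameter `α` started at `x₀`:
`X 0 = x₀` and `X (n+1) = X n + α (P_{C (ξ n)} (X n) - X n)`. -/
noncomputable def randProjIter {k : ℕ} {W I : Type*} (C : I → Set (EuclideanSpace ℝ (Fin k)))
    (α : ℝ) (ξ : ℕ → W → I) (x₀ : EuclideanSpace ℝ (Fin k)) :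
    ℕ → W → EuclideanSpace ℝ (Fin k)
  | 0, _ => x₀
  | n + 1, w =>
      randProjIter C α ξ x₀ n w +
        α • (metricProj (C (ξ n w)) (randProjIter C α ξ x₀ n w) - randProjIter C α ξ x₀ n w)

/-! On path space, `X n` is a composition of relaxed projections along an orbit of the shift. Each
is nonexpansive, fixes its set, and for `α ∈ (0,2)` moves every other point strictly closer to each
point of the set. Hence distances to points of `C*` never increase, and it remains to show that the
distance to `C*` tends to 0.

Consider all starting points in a ball around some `p ∈ C*`. For each level `q`, the event that at
every time some of them is still at distance at least `q` from `C*` is null or almost sure, by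
ergodicity. Let `c` be the supremum of the almost sure levels. Stationarity then yields, for every
`N` and `δ > 0`, a point whose distance stays in `[c - δ, c + δ]` for `N` steps. Compactness gives a
point whose distance never falls below its initial value `c`. By strictness every map along the
orbit fixes it, and ergodicity puts such a point in `C*`, so `c = 0`. Monotonicity of distances then
upgrades this to convergence. -/

/-- The random composition `T (θⁿ⁻¹ ω) ∘ ⋯ ∘ T (θ ω) ∘ T ω`. -/
def cocycleIter {Ω E : Type*} (θ : Ω → Ω) (T : Ω → E → E) : ℕ → Ω → E → E
  | 0, _, z => z
  | n + 1, ω, z => T (θ^[n] ω) (cocycleIter θ T n ω z)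

theorem cocycleIter_add {Ω E : Type*} (θ : Ω → Ω) (T : Ω → E → E) (n m : ℕ) (ω : Ω) (z : E) :
    cocycleIter θ T (n + m) ω z = cocycleIter θ T m (θ^[n] ω) (cocycleIter θ T n ω z) := by
  induction m with
  | zero => rfl
  | succ m ih =>
    rw [← add_assoc, cocycleIter, cocycleIter, ih, ← Function.iterate_add_apply, add_comm m n]

/-- A measurable family of nonexpansive maps fixing every point of `S`, strictly decreasing the
distance to the points of `S` at every non-fixed point, and whose almost sure common fixed points
lie in `S`. -/
structure IsFejerFamily {Ω E : Type*} [MeasurableSpace Ω] [MetricSpace E] [MeasurableSpace E]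
    (μ : Measure Ω) (T : Ω → E → E) (S : Set E) : Prop where
  measurable : ∀ z, Measurable fun ω => T ω z
  dist_le : ∀ ω x y, dist (T ω x) (T ω y) ≤ dist x y
  fix : ∀ ω, ∀ p ∈ S, T ω p = p
  strict : ∀ ω, ∀ p ∈ S, ∀ z, dist z p ≤ dist (T ω z) p → T ω z = z
  mem_of_ae : ∀ z, (∀ᵐ ω ∂μ, T ω z = z) → z ∈ S
  isClosed : IsClosed S
  nonempty : S.Nonempty

/-! ### Measurability and recurrence tools -/

/-- For `F` measurable in the first and continuous in the second variable, the projection of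
`{F ≥ 0}` along a compact set is measurable. -/
theorem measurableSet_exists_mem_nonneg {Ω E : Type*} [MeasurableSpace Ω] [MetricSpace E]
    {K : Set E} (hK : IsCompact K) {F : Ω → E → ℝ} (hm : ∀ z, Measurable fun ω => F ω z)
    (hc : ∀ ω, Continuous (F ω)) : MeasurableSet {ω | ∃ z ∈ K, 0 ≤ F ω z} := by
  obtain ⟨D, hDK, hD, hKD⟩ := hK.isSeparable.exists_countable_dense_subset
  have key : {ω | ∃ z ∈ K, 0 ≤ F ω z}
      = ⋂ m : ℕ, ⋃ z ∈ D, {ω | -(1 / ((m : ℝ) + 1)) < F ω z} := by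
    ext ω
    simp only [Set.mem_ofPred_eq, Set.mem_iInter, Set.mem_iUnion, exists_prop]
    constructor
    · rintro ⟨z, hz, h0⟩ m
      have ho : IsOpen {y | -(1 / ((m : ℝ) + 1)) < F ω y} := isOpen_lt continuous_const (hc ω)
      have hpos : (0 : ℝ) < 1 / ((m : ℝ) + 1) := by positivity
      obtain ⟨y, hy, hyD⟩ := mem_closure_iff.1 (hKD hz) _ ho
        (show -(1 / ((m : ℝ) + 1)) < F ω z by linarith)
      exact ⟨y, hyD, hy⟩
    · intro h
      obtain ⟨y, hy, -⟩ := h 0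
      -- The maximum over `K` exceeds every `-1/(m+1)`, hence is nonnegative.
      obtain ⟨z, hz, hmax⟩ := hK.exists_isMaxOn ⟨y, hDK hy⟩ (hc ω).continuousOn
      refine ⟨z, hz, ?_⟩
      have hlim : Tendsto (fun m : ℕ => -(1 / ((m : ℝ) + 1))) atTop (𝓝 0) := by
        simpa using (tendsto_one_div_add_atTop_nhds_zero_nat (𝕜 := ℝ)).neg
      refine le_of_tendsto' hlim fun m => ?_
      obtain ⟨x, hx, hx'⟩ := h m
      exact hx'.le.trans (hmax (hDK hx))
  rw [key]
  exact .iInter fun m => .biUnion hD fun z _ => measurableSet_lt measurable_const (hm z)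

/-- An orbit of an ergodic transformation almost surely visits a set of positive measure. -/
theorem Ergodic.ae_exists_iterate_mem {Ω : Type*} [MeasurableSpace Ω] {μ : Measure Ω}
    [IsFiniteMeasure μ] {θ : Ω → Ω} (hθ : Ergodic θ μ) {A : Set Ω} (hA : MeasurableSet A)
    (h0 : μ A ≠ 0) : ∀ᵐ ω ∂μ, ∃ n, θ^[n] ω ∈ A := by
  have hU : MeasurableSet {ω | ∃ n, θ^[n] ω ∈ A} := by
    have : {ω | ∃ n, θ^[n] ω ∈ A} = ⋃ n, θ^[n] ⁻¹' A := by ext; simp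
    rw [this]
    exact .iUnion fun n => hθ.measurable.iterate n hA
  rcases hθ.ae_empty_or_univ_of_preimage_ae_le hU.nullMeasurableSet
    (Eventually.of_forall fun ω ⟨n, hn⟩ => ⟨n + 1, hn⟩) with h | h
  · refine absurd (measure_mono_null ?_ (ae_eq_empty.1 h)) h0
    exact fun ω hω => ⟨0, hω⟩
  · exact eventuallyEq_univ.1 h

/-! ### Fejér families along an ergodic transformation -/

namespace IsFejerFamily

section

variable {Ω E : Type*} [MeasurableSpace Ω] [MetricSpace E] [MeasurableSpace E] {μ : Measure Ω} {T : Ω → E → E} {S : Set E} {θ : Ω → Ω}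

theorem continuous (h : IsFejerFamily μ T S) (ω : Ω) : Continuous (T ω) :=
  (LipschitzWith.of_dist_le_mul (K := 1) (by simpa using h.dist_le ω)).continuous

theorem continuous_cocycleIter (h : IsFejerFamily μ T S) (n : ℕ) (ω : Ω) :
    Continuous (cocycleIter θ T n ω) := by
  induction n with
  | zero => exact continuous_id
  | succ n ih => exact (h.continuous _).comp ih

theorem measurable_comp [ProperSpace E] [BorelSpace E]
    (h : IsFejerFamily μ T S) {f : Ω → Ω} (hf : Measurable f) {g : Ω → E}
    (hg : Measurable g) : Measurable fun ω => T (f ω) (g ω) :=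
  (measurable_uncurry_of_continuous_of_measurable (u := fun z ω => T ω z)
    h.continuous h.measurable).comp (hg.prodMk hf)

theorem measurable_cocycleIter [ProperSpace E] [BorelSpace E]
    (h : IsFejerFamily μ T S) (hθ : Measurable θ) (n : ℕ) (z : E) :
    Measurable fun ω => cocycleIter θ T n ω z := by
  induction n with
  | zero => exact measurable_const
  | succ n ih => exact h.measurable_comp (hθ.iterate n) ih

theorem dist_apply_le (h : IsFejerFamily μ T S) (ω : Ω) {p : E} (hp : p ∈ S) (z : E) :
    dist (T ω z) p ≤ dist z p := by
  simpa [h.fix ω p hp] using h.dist_le ω z p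

theorem infDist_apply_le (h : IsFejerFamily μ T S) (ω : Ω) (z : E) :
    Metric.infDist (T ω z) S ≤ Metric.infDist z S :=
  (Metric.le_infDist h.nonempty).2 fun _ hp =>
    (Metric.infDist_le_dist_of_mem hp).trans (h.dist_apply_le ω hp z)

/-- Strictness is applied at a nearest point of `S`, which exists by properness. -/
theorem apply_eq_of_infDist_le [ProperSpace E] (h : IsFejerFamily μ T S) (ω : Ω) {z : E}
    (hz : Metric.infDist z S ≤ Metric.infDist (T ω z) S) : T ω z = z := by
  obtain ⟨p, hp, hpd⟩ := h.isClosed.exists_infDist_eq_dist h.nonempty z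
  exact h.strict ω p hp z (hpd ▸ hz.trans (Metric.infDist_le_dist_of_mem hp))

theorem antitone_dist (h : IsFejerFamily μ T S) (ω : Ω) {p : E} (hp : p ∈ S) (z : E) :
    Antitone fun n => dist (cocycleIter θ T n ω z) p :=
  antitone_nat_of_succ_le fun _ => h.dist_apply_le _ hp _

theorem antitone_infDist (h : IsFejerFamily μ T S) (ω : Ω) (z : E) :
    Antitone fun n => Metric.infDist (cocycleIter θ T n ω z) S :=
  antitone_nat_of_succ_le fun _ => h.infDist_apply_le _ _

/-- The exceptional event must not depend on `z`. Only countably many recurrence events are used,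
one for each point of a dense set and each threshold; nonexpansiveness transfers them to `z`. -/
theorem ae_mem_of_forall_fixed [ProperSpace E] [BorelSpace E]
    [IsFiniteMeasure μ] (h : IsFejerFamily μ T S)
    (hθ : Ergodic θ μ) : ∀ᵐ ω ∂μ, ∀ z, (∀ n, T (θ^[n] ω) z = z) → z ∈ S := by
  obtain ⟨D, hDc, hD⟩ := TopologicalSpace.exists_countable_dense E
  have hvis : ∀ᵐ ω ∂μ, ∀ q ∈ D, ∀ m : ℕ,
      μ {ω | 2 / ((m : ℝ) + 1) < dist (T ω q) q} ≠ 0 →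
        ∃ n, θ^[n] ω ∈ {ω | 2 / ((m : ℝ) + 1) < dist (T ω q) q} := by
    rw [ae_ball_iff hDc]
    intro q _
    rw [ae_all_iff]
    intro m
    by_cases h0 : μ {ω | 2 / ((m : ℝ) + 1) < dist (T ω q) q} = 0
    · exact Eventually.of_forall fun ω h1 => absurd h0 h1
    · filter_upwards [hθ.ae_exists_iterate_mem
        (measurableSet_lt measurable_const ((h.measurable q).dist measurable_const)) h0]
        with ω hω _ using hω
  filter_upwards [hvis] with ω hω z hz
  refine h.mem_of_ae z ?_
  have hsmall : ∀ m : ℕ, ∀ᵐ ω ∂μ, dist (T ω z) z ≤ 4 * (1 / ((m : ℝ) + 1)) := by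
    intro m
    have hpos : (0 : ℝ) < 1 / ((m : ℝ) + 1) := by positivity
    obtain ⟨q, hq, hqz⟩ := hD.exists_dist_lt z hpos
    have h2 : 2 / ((m : ℝ) + 1) = 2 * (1 / ((m : ℝ) + 1)) := by ring
    -- The orbit fixes `z`, so it moves `q` by less than `2/(m+1)` and never visits this set.
    -- Returning from `q` to `z` costs as much again, hence the 4 in `hsmall`.
    have hnull : μ {ω | 2 / ((m : ℝ) + 1) < dist (T ω q) q} = 0 := by
      by_contra hne
      obtain ⟨n, hn⟩ := hω q hq m hne
      have h3 := h.dist_le (θ^[n] ω) q z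
      rw [hz n] at h3
      have h4 := dist_triangle (T (θ^[n] ω) q) z q
      have h5 := dist_comm q z
      have h6 : 2 / ((m : ℝ) + 1) < dist (T (θ^[n] ω) q) q := hn
      linarith
    have : ∀ᵐ ω ∂μ, ¬ 2 / ((m : ℝ) + 1) < dist (T ω q) q := by
      simpa [ae_iff] using hnull
    filter_upwards [this] with ω' h6
    have h3 := h.dist_le ω' z q
    have h4 := dist_triangle4 (T ω' z) (T ω' q) q z
    have h5 := dist_comm q z
    linarith
  filter_upwards [ae_all_iff.2 hsmall] with ω' h6
  have : Tendsto (fun m : ℕ => 4 * (1 / ((m : ℝ) + 1))) atTop (𝓝 (4 * 0)) :=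
    tendsto_one_div_add_atTop_nhds_zero_nat.const_mul 4
  rw [mul_zero] at this
  exact dist_le_zero.1 (ge_of_tendsto' this h6)

/-- The event that some point of the closed ball is still at distance at least `q` from `S` at
time `n`. -/
def farSet (θ : Ω → Ω) (T : Ω → E → E) (S : Set E) (p : E) (R : ℝ) (n : ℕ) (q : ℝ) : Set Ω :=
  {ω | ∃ z ∈ Metric.closedBall p R, q ≤ Metric.infDist (cocycleIter θ T n ω z) S}

theorem measurableSet_farSet [ProperSpace E] [BorelSpace E]
    (h : IsFejerFamily μ T S) (hθ : Measurable θ) (p : E) (R : ℝ)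
    (n : ℕ) (q : ℝ) : MeasurableSet (farSet θ T S p R n q) := by
  have := measurableSet_exists_mem_nonneg (isCompact_closedBall p R)
    (F := fun ω z => Metric.infDist (cocycleIter θ T n ω z) S - q)
    (fun z => ((h.measurable_cocycleIter hθ n z).infDist).sub_const q)
    (fun ω => ((Metric.continuous_infDist_pt S).comp
      (h.continuous_cocycleIter n ω)).sub continuous_const)
  simpa only [sub_nonneg, farSet] using this

theorem antitone_farSet (h : IsFejerFamily μ T S) (p : E) (R : ℝ) (q : ℝ) :
    Antitone fun n => farSet θ T S p R n q :=
  fun _ _ hnm ω ⟨z, hz, hq⟩ => ⟨z, hz, hq.trans (h.antitone_infDist ω z hnm)⟩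

theorem iInter_farSet_ae [ProperSpace E] [BorelSpace E]
    [IsFiniteMeasure μ] (h : IsFejerFamily μ T S) (hθ : Ergodic θ μ)
    {p : E} (hp : p ∈ S) (R q : ℝ) :
    μ (⋂ n, farSet θ T S p R n q) = 0 ∨ ∀ᵐ ω ∂μ, ∀ n, ω ∈ farSet θ T S p R n q := by
  have hm : MeasurableSet (⋂ n, farSet θ T S p R n q) :=
    .iInter fun n => h.measurableSet_farSet hθ.measurable p R n q
  have hinv : ∀ ω ∈ ⋂ n, farSet θ T S p R n q, ω ∈ θ ⁻¹' ⋂ n, farSet θ T S p R n q := by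
    refine fun ω hω => Set.mem_iInter.2 fun n => ?_
    -- Time `n` on the shifted path is time `1 + n` on the original one, with starting point `T ω
    -- z`, still in the ball.
    obtain ⟨z, hz, hq⟩ := Set.mem_iInter.1 hω (1 + n)
    rw [cocycleIter_add] at hq
    exact ⟨T ω z, (h.dist_apply_le ω hp z).trans hz, hq⟩
  rcases hθ.ae_empty_or_univ_of_ae_le_preimage hm.nullMeasurableSet
    (Eventually.of_forall hinv) with h1 | h1
  · exact .inl (ae_eq_empty.1 h1)
  · right
    filter_upwards [eventuallyEq_univ.1 h1] with ω hω using Set.mem_iInter.1 hω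

theorem ae_exists_almost_stationary [ProperSpace E] [BorelSpace E]
    [IsProbabilityMeasure μ] (h : IsFejerFamily μ T S)
    (hθ : Ergodic θ μ) {p : E} (hp : p ∈ S) {R c δ : ℝ}
    (hlow : ∀ᵐ ω ∂μ, ∀ n, ω ∈ farSet θ T S p R n (c - δ))
    (hupp : μ (⋂ n, farSet θ T S p R n (c + δ)) = 0) (N : ℕ) :
    ∀ᵐ ω ∂μ, ∃ z ∈ Metric.closedBall p R, Metric.infDist z S ≤ c + δ ∧
      c - δ ≤ Metric.infDist (cocycleIter θ T N ω z) S := by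
  set G : Set Ω := {ω | ∃ z ∈ Metric.closedBall p R, Metric.infDist z S ≤ c + δ ∧
      c - δ ≤ Metric.infDist (cocycleIter θ T N ω z) S} with hG
  have hGm : MeasurableSet G := by
    have := measurableSet_exists_mem_nonneg (isCompact_closedBall p R)
      (F := fun ω z => min (c + δ - Metric.infDist z S)
        (Metric.infDist (cocycleIter θ T N ω z) S - (c - δ)))
      (fun z => measurable_const.min
        (((h.measurable_cocycleIter hθ.measurable N z).infDist).sub_const _))
      (fun ω => (continuous_const.sub (Metric.continuous_infDist_pt S)).min
        (((Metric.continuous_infDist_pt S).comp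
          (h.continuous_cocycleIter N ω)).sub continuous_const))
    simpa only [le_min_iff, sub_nonneg] using this
  have hle : ∀ n, μ Gᶜ ≤ μ (farSet θ T S p R n (c + δ)) := by
    intro n
    -- By stationarity the failure is tested on the path shifted by `n`. There a point that is far
    -- at time `n + N` must already be above level `c + δ` at time `n`, which has vanishing
    -- probability as `n` grows.
    rw [← (hθ.toMeasurePreserving.iterate n).measure_preimage hGm.compl.nullMeasurableSet]
    refine measure_mono_ae ?_
    filter_upwards [hlow] with ω hω hnG
    obtain ⟨z, hz, hq⟩ := hω (n + N)
    refine ⟨z, hz, ?_⟩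
    by_contra! hlt
    refine hnG ⟨cocycleIter θ T n ω z, ?_, hlt.le, ?_⟩
    · exact (h.antitone_dist (θ := θ) ω hp z (Nat.zero_le n)).trans hz
    · rwa [cocycleIter_add] at hq
  have hlim := tendsto_measure_iInter_atTop (μ := μ)
    (fun n => (h.measurableSet_farSet hθ.measurable p R n (c + δ)).nullMeasurableSet)
    (h.antitone_farSet p R (c + δ)) ⟨0, measure_ne_top _ _⟩
  rw [hupp] at hlim
  have : μ Gᶜ ≤ 0 := ge_of_tendsto' hlim hle
  exact le_antisymm this bot_le

theorem fixed_of_infDist_ge [ProperSpace E] (h : IsFejerFamily μ T S) {ω : Ω} {z : E}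
    (hz : ∀ n, Metric.infDist z S ≤ Metric.infDist (cocycleIter θ T n ω z) S) (n : ℕ) :
    T (θ^[n] ω) z = z := by
  have hfix : ∀ n, cocycleIter θ T n ω z = z := by
    intro n
    induction n with
    | zero => rfl
    | succ n ih =>
      have := hz (n + 1)
      rw [cocycleIter, ih] at this ⊢
      exact h.apply_eq_of_infDist_le _ this
  have := hfix (n + 1)
  rwa [cocycleIter, hfix n] at this

theorem measure_iInter_farSet_eq_zero [ProperSpace E] [BorelSpace E]
    [IsProbabilityMeasure μ] (h : IsFejerFamily μ T S)
    (hθ : Ergodic θ μ) {p : E} (hp : p ∈ S) {R : ℝ} (hR : 0 ≤ R) {q : ℝ} (hq : 0 < q) :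
    μ (⋂ n, farSet θ T S p R n q) = 0 := by
  set Q : Set ℝ := {q | ∀ᵐ ω ∂μ, ∀ n, ω ∈ farSet θ T S p R n q} with hQ
  have hbdd : BddAbove Q := by
    refine ⟨R, fun q hq => ?_⟩
    have hq' : ∀ᵐ ω ∂μ, ∀ n, ω ∈ farSet θ T S p R n q := hq
    obtain ⟨ω, hω⟩ := hq'.exists
    obtain ⟨z, hz, hle⟩ := hω 0
    exact hle.trans ((Metric.infDist_le_dist_of_mem hp).trans hz)
  have h0 : (0 : ℝ) ∈ Q := Set.mem_ofPred_eq ▸ Eventually.of_forall fun ω n =>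
    ⟨p, Metric.mem_closedBall_self hR, Metric.infDist_nonneg⟩
  set c := sSup Q with hc
  have hlow : ∀ δ > 0, ∀ᵐ ω ∂μ, ∀ n, ω ∈ farSet θ T S p R n (c - δ) := by
    intro δ hδ
    obtain ⟨q, hq, hlt⟩ := exists_lt_of_lt_csSup ⟨0, h0⟩ (sub_lt_self c hδ)
    filter_upwards [hq] with ω hω n
    obtain ⟨z, hz, hle⟩ := hω n
    exact ⟨z, hz, hlt.le.trans hle⟩
  have hupp : ∀ q, c < q → μ (⋂ n, farSet θ T S p R n q) = 0 := fun q hcq =>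
    (h.iInter_farSet_ae hθ hp R q).resolve_right fun hmem => hcq.not_ge (le_csSup hbdd hmem)
  refine hupp q ?_
  have hst : ∀ᵐ ω ∂μ, ∀ N : ℕ, ∃ z ∈ Metric.closedBall p R,
      Metric.infDist z S ≤ c + 1 / ((N : ℝ) + 1) ∧
        c - 1 / ((N : ℝ) + 1) ≤ Metric.infDist (cocycleIter θ T N ω z) S := by
    refine ae_all_iff.2 fun N => ?_
    have hpos : (0 : ℝ) < 1 / ((N : ℝ) + 1) := by positivity
    exact h.ae_exists_almost_stationary hθ hp (hlow _ hpos) (hupp _ (by linarith)) N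
  -- One good path suffices: the almost stationary points for horizon `N` and tolerance `1/(N+1)`
  -- accumulate in the ball.
  obtain ⟨ω, hω, hfix⟩ := (hst.and (h.ae_mem_of_forall_fixed hθ)).exists
  choose u hu hu1 hu2 using hω
  obtain ⟨z, -, φ, hφ, hlim⟩ := (isCompact_closedBall p R).tendsto_subseq hu
  have hinv := tendsto_one_div_add_atTop_nhds_zero_nat (𝕜 := ℝ) |>.comp hφ.tendsto_atTop
  have hcont := Metric.continuous_infDist_pt S
  have hz1 : Metric.infDist z S ≤ c := by
    refine le_of_tendsto_of_tendsto' ((hcont.tendsto z).comp hlim)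
      (by simpa using hinv.const_add c) fun j => hu1 (φ j)
  have hz2 : ∀ n, c ≤ Metric.infDist (cocycleIter θ T n ω z) S := by
    intro n
    have hinv' := hinv.const_sub c
    rw [sub_zero] at hinv'
    refine le_of_tendsto_of_tendsto hinv'
      (((hcont.comp (h.continuous_cocycleIter n ω)).tendsto z).comp hlim) ?_
    filter_upwards [hφ.tendsto_atTop.eventually_ge_atTop n] with j hj
    exact (hu2 (φ j)).trans (h.antitone_infDist ω (u (φ j)) hj)
  have hzS := hfix z (h.fixed_of_infDist_ge fun n => hz1.trans (hz2 n))
  have := hz2 0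
  rw [cocycleIter, Metric.infDist_zero_of_mem hzS] at this
  exact this.trans_lt hq

/-- Random compositions of a Fejér family along an ergodic transformation converge almost surely,
with limit in `S`. -/
theorem ae_exists_tendsto [ProperSpace E] [BorelSpace E]
    [IsProbabilityMeasure μ] (h : IsFejerFamily μ T S)
    (hθ : Ergodic θ μ) (x₀ : E) :
    ∀ᵐ ω ∂μ, ∃ x ∈ S, Tendsto (fun n => cocycleIter θ T n ω x₀) atTop (𝓝 x) := by
  obtain ⟨p, hp⟩ := h.nonempty
  have hfar : ∀ᵐ ω ∂μ, ∀ k : ℕ, ω ∉ ⋂ n, farSet θ T S p (dist x₀ p) n (1 / ((k : ℝ) + 1)) :=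
    ae_all_iff.2 fun k =>
      measure_eq_zero_iff_ae_notMem.1
        (h.measure_iInter_farSet_eq_zero hθ hp dist_nonneg (by positivity))
  filter_upwards [hfar] with ω hω
  have hlim : Tendsto (fun n => Metric.infDist (cocycleIter θ T n ω x₀) S) atTop (𝓝 0) := by
    refine Metric.tendsto_atTop.2 fun ε hε => ?_
    obtain ⟨k, hk⟩ := exists_nat_one_div_lt hε
    have := hω k
    simp only [Set.mem_iInter, not_forall] at this
    obtain ⟨n, hn⟩ := this
    refine ⟨n, fun m hm => ?_⟩
    rw [Real.dist_0_eq_abs, abs_of_nonneg Metric.infDist_nonneg]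
    refine (h.antitone_infDist ω x₀ hm).trans_lt (lt_trans ?_ hk)
    by_contra! hle
    exact hn ⟨x₀, Metric.mem_closedBall.2 le_rfl, hle⟩
  -- Later terms are no further from the point of `S` nearest to the `n`th term, whence the factor
  -- 2.
  have hcau : CauchySeq fun n => cocycleIter θ T n ω x₀ := by
    refine cauchySeq_of_le_tendsto_0' (fun n => 2 * Metric.infDist (cocycleIter θ T n ω x₀) S)
      (fun n m hnm => ?_) (by simpa using hlim.const_mul 2)
    obtain ⟨y, hy, hyd⟩ :=
      h.isClosed.exists_infDist_eq_dist h.nonempty (cocycleIter θ T n ω x₀)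
    have h1 : dist (cocycleIter θ T m ω x₀) y ≤ dist (cocycleIter θ T n ω x₀) y :=
      h.antitone_dist ω hy x₀ hnm
    have h2 := dist_triangle_right (cocycleIter θ T n ω x₀) (cocycleIter θ T m ω x₀) y
    simp only [hyd]
    linarith
  obtain ⟨x, hx⟩ := cauchySeq_tendsto_of_complete hcau
  refine ⟨x, ?_, hx⟩
  rw [h.isClosed.mem_iff_infDist_zero h.nonempty]
  exact tendsto_nhds_unique (((Metric.continuous_infDist_pt S).tendsto x).comp hx) hlim

end

end IsFejerFamily
-- Relaxed metric projections
open scoped InnerProductSpace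

theorem inner_sub_metricProj_le_zero {k : ℕ} {C : Set (EuclideanSpace ℝ (Fin k))}
    (hne : C.Nonempty) (hcl : IsClosed C) (hcv : Convex ℝ C) (x : EuclideanSpace ℝ (Fin k))
    {y : EuclideanSpace ℝ (Fin k)} (hy : y ∈ C) :
    ⟪x - metricProj C x, y - metricProj C x⟫_ℝ ≤ 0 := by
  obtain ⟨hp, hmin⟩ := metricProj_spec hne hcl x
  have : Nonempty C := hne.to_subtype
  refine (norm_eq_iInf_iff_real_inner_le_zero hcv hp).1 (le_antisymm ?_ ?_) y hy
  · exact le_ciInf fun w => by simpa only [dist_eq_norm] using hmin w w.2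
  · exact ciInf_le (f := fun w : C => ‖x - w‖)
      ⟨0, Set.forall_mem_range.2 fun _ => norm_nonneg _⟩ ⟨_, hp⟩

theorem metricProj_eq_self_iff {k : ℕ} {C : Set (EuclideanSpace ℝ (Fin k))}
    (hne : C.Nonempty) (hcl : IsClosed C) {x : EuclideanSpace ℝ (Fin k)} :
    metricProj C x = x ↔ x ∈ C := by
  refine ⟨fun h => h ▸ metricProj_mem hne hcl x, fun h => ?_⟩
  have := dist_metricProj_le hne hcl x h
  rw [dist_self] at this
  exact (dist_le_zero.1 this).symm

/-- The complement `id - P_C` of the metric projection is firmly nonexpansive. -/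
theorem norm_sq_sub_le_inner_metricProj {k : ℕ} {C : Set (EuclideanSpace ℝ (Fin k))}
    (hne : C.Nonempty) (hcl : IsClosed C) (hcv : Convex ℝ C) (x y : EuclideanSpace ℝ (Fin k)) :
    ‖(x - metricProj C x) - (y - metricProj C y)‖ ^ 2 ≤
      ⟪x - y, (x - metricProj C x) - (y - metricProj C y)⟫_ℝ := by
  have hx := inner_sub_metricProj_le_zero hne hcl hcv x (metricProj_mem hne hcl y)
  have hy := inner_sub_metricProj_le_zero hne hcl hcv y (metricProj_mem hne hcl x)
  set p := metricProj C x
  set q := metricProj C y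
  rw [← real_inner_self_eq_norm_sq, ← sub_nonneg, ← inner_sub_left]
  have h1 : x - y - (x - p - (y - q)) = p - q := by abel
  have h2 : ⟪p - q, x - p - (y - q)⟫_ℝ = -⟪x - p, q - p⟫_ℝ - ⟪y - q, p - q⟫_ℝ := by
    rw [inner_sub_right, real_inner_comm, real_inner_comm (y - q), ← neg_sub q p,
      inner_neg_right]
  rw [h1, h2]
  linarith

/-- The relaxed metric projection `x ↦ x + α (P_C x - x)`. -/
noncomputable def relaxedProj {k : ℕ} (α : ℝ) (C : Set (EuclideanSpace ℝ (Fin k)))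
    (x : EuclideanSpace ℝ (Fin k)) : EuclideanSpace ℝ (Fin k) :=
  x + α • (metricProj C x - x)

/-- Expanding the square, firm nonexpansiveness bounds the cross term by `-2α‖e‖²`, against the
quadratic term `α²‖e‖²`. The resulting loss is what makes the maps strict. -/
theorem dist_relaxedProj_sq_le {k : ℕ} {C : Set (EuclideanSpace ℝ (Fin k))}
    (hne : C.Nonempty) (hcl : IsClosed C) (hcv : Convex ℝ C) {α : ℝ} (hα : 0 ≤ α)
    (x y : EuclideanSpace ℝ (Fin k)) :
    dist (relaxedProj α C x) (relaxedProj α C y) ^ 2 ≤ dist x y ^ 2 -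
      α * (2 - α) * ‖(x - metricProj C x) - (y - metricProj C y)‖ ^ 2 := by
  have h := norm_sq_sub_le_inner_metricProj hne hcl hcv x y
  set e := (x - metricProj C x) - (y - metricProj C y) with he
  have h1 : relaxedProj α C x - relaxedProj α C y = (x - y) - α • e := by
    simp only [relaxedProj, he, smul_sub]
    abel
  rw [dist_eq_norm, dist_eq_norm, h1, norm_sub_sq_real, inner_smul_right, norm_smul, mul_pow,
    Real.norm_eq_abs, sq_abs]
  linarith [mul_le_mul_of_nonneg_left h hα]

theorem relaxedProj_of_mem {k : ℕ} {C : Set (EuclideanSpace ℝ (Fin k))}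
    (hne : C.Nonempty) (hcl : IsClosed C) (α : ℝ) {x : EuclideanSpace ℝ (Fin k)} (hx : x ∈ C) :
    relaxedProj α C x = x := by
  simp [relaxedProj, (metricProj_eq_self_iff hne hcl).2 hx]

theorem dist_relaxedProj_le {k : ℕ} {C : Set (EuclideanSpace ℝ (Fin k))}
    (hne : C.Nonempty) (hcl : IsClosed C) (hcv : Convex ℝ C) {α : ℝ} (hα : α ∈ Set.Ioo (0 : ℝ) 2)
    (x y : EuclideanSpace ℝ (Fin k)) :
    dist (relaxedProj α C x) (relaxedProj α C y) ≤ dist x y := by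
  refine le_of_sq_le_sq ?_ dist_nonneg
  refine (dist_relaxedProj_sq_le hne hcl hcv hα.1.le x y).trans (sub_le_self _ ?_)
  have := sub_pos.2 hα.2
  have := hα.1
  positivity

theorem mem_of_dist_le_dist_relaxedProj {k : ℕ} {C : Set (EuclideanSpace ℝ (Fin k))}
    (hne : C.Nonempty) (hcl : IsClosed C) (hcv : Convex ℝ C) {α : ℝ} (hα : α ∈ Set.Ioo (0 : ℝ) 2)
    {p x : EuclideanSpace ℝ (Fin k)} (hp : p ∈ C) (h : dist x p ≤ dist (relaxedProj α C x) p) :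
    x ∈ C := by
  have h1 := dist_relaxedProj_sq_le hne hcl hcv hα.1.le x p
  rw [relaxedProj_of_mem hne hcl α hp, (metricProj_eq_self_iff hne hcl).2 hp, sub_self,
    sub_zero] at h1
  have h2 : dist x p ^ 2 ≤ dist (relaxedProj α C x) p ^ 2 := by gcongr
  have h3 : 0 < α * (2 - α) := mul_pos hα.1 (sub_pos.2 hα.2)
  have h4 : ‖x - metricProj C x‖ ^ 2 ≤ 0 := by
    by_contra! h5
    linarith [mul_pos h3 h5]
  have h5 : x - metricProj C x = 0 := by
    rw [← norm_eq_zero]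
    exact pow_eq_zero_iff two_ne_zero |>.1 (le_antisymm h4 (sq_nonneg _))
  exact (metricProj_eq_self_iff hne hcl).1 (sub_eq_zero.1 h5).symm

theorem relaxedProj_eq_self_iff {k : ℕ} {C : Set (EuclideanSpace ℝ (Fin k))}
    (hne : C.Nonempty) (hcl : IsClosed C) {α : ℝ} (hα : α ≠ 0) {x : EuclideanSpace ℝ (Fin k)} :
    relaxedProj α C x = x ↔ x ∈ C := by
  rw [relaxedProj, add_eq_left, smul_eq_zero_iff_right hα, sub_eq_zero,
    metricProj_eq_self_iff hne hcl]

/-! ### The set `C*` and the iteration on path space -/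

/-- Almost every `C i` contains all of `C*`. -/
theorem ae_aeInter_subset {k : ℕ} {I : Type*} [MeasurableSpace I] {ν : Measure I}
    {C : I → Set (EuclideanSpace ℝ (Fin k))} (hcl : ∀ i, IsClosed (C i)) :
    ∀ᵐ i ∂ν, aeInter ν C ⊆ C i := by
  -- A countable dense subset of `C*` gives a common null set; closedness of `C i` does the rest.
  obtain ⟨D, hDS, hDc, hD⟩ := (TopologicalSpace.IsSeparable.of_separableSpace
    (aeInter ν C)).exists_countable_dense_subset
  have : ∀ᵐ i ∂ν, ∀ p ∈ D, p ∈ C i := (ae_ball_iff hDc).2 fun p hp => hDS hp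
  filter_upwards [this] with i hi
  exact hD.trans (closure_minimal hi (hcl i))

theorem isClosed_aeInter {k : ℕ} {I : Type*} [MeasurableSpace I] {ν : Measure I}
    {C : I → Set (EuclideanSpace ℝ (Fin k))} (hcl : ∀ i, IsClosed (C i)) :
    IsClosed (aeInter ν C) := by
  refine isClosed_of_closure_subset fun x hx => ?_
  have : ∀ᵐ i ∂ν, x ∈ C i := by
    filter_upwards [ae_aeInter_subset (ν := ν) hcl] with i hi
    exact closure_minimal hi (hcl i) hx
  exact this

theorem continuous_relaxedProj {k : ℕ} {C : Set (EuclideanSpace ℝ (Fin k))}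
    (hne : C.Nonempty) (hcl : IsClosed C) (hcv : Convex ℝ C) {α : ℝ}
    (hα : α ∈ Set.Ioo (0 : ℝ) 2) : Continuous (relaxedProj α C) :=
  (LipschitzWith.of_dist_le_mul (K := 1)
    (by simpa using dist_relaxedProj_le hne hcl hcv hα)).continuous

theorem measurable_randProjIter {k : ℕ} {I W : Type*} [MeasurableSpace I] [MeasurableSpace W]
    {C : I → Set (EuclideanSpace ℝ (Fin k))}
    (hne : ∀ i, (C i).Nonempty) (hcl : ∀ i, IsClosed (C i)) (hcv : ∀ i, Convex ℝ (C i))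
    (hmeas : ∀ x, Measurable fun i => metricProj (C i) x) {α : ℝ} (hα : α ∈ Set.Ioo (0 : ℝ) 2)
    {ξ : ℕ → W → I} (hξ : ∀ n, Measurable (ξ n)) (x₀ : EuclideanSpace ℝ (Fin k)) (n : ℕ) :
    Measurable (randProjIter C α ξ x₀ n) := by
  induction n with
  | zero => exact measurable_const
  | succ n ih =>
    have hm : ∀ x, Measurable fun i => relaxedProj α (C i) x := fun x =>
      (((hmeas x).sub_const x).const_smul α).const_add x
    exact (measurable_uncurry_of_continuous_of_measurable (u := fun x i => relaxedProj α (C i) x)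
      (fun i => continuous_relaxedProj (hne i) (hcl i) (hcv i) hα) hm).comp (ih.prodMk (hξ n))

open Classical in
/-- On path space, the relaxed projections, replaced by the identity outside an event on which
`C*` is contained in the current set, form a Fejér family for `C*`. -/
theorem isFejerFamily_relaxedProj {k : ℕ} {I : Type*} [MeasurableSpace I] {ν : Measure I}
    {C : I → Set (EuclideanSpace ℝ (Fin k))}
    (hne : ∀ i, (C i).Nonempty) (hcl : ∀ i, IsClosed (C i)) (hcv : ∀ i, Convex ℝ (C i))
    (hmeas : ∀ x, Measurable fun i => metricProj (C i) x) (hstar : (aeInter ν C).Nonempty)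
    {α : ℝ} (hα : α ∈ Set.Ioo (0 : ℝ) 2) {μ : Measure (ℕ → I)}
    (hμ : μ.map (fun ω => ω 0) = ν) {G : Set I} (hG : MeasurableSet G) (hGν : G ∈ ae ν)
    (hGC : ∀ i ∈ G, aeInter ν C ⊆ C i) :
    IsFejerFamily μ (fun ω z => if ω 0 ∈ G then relaxedProj α (C (ω 0)) z else z)
      (aeInter ν C) where
  measurable z := by
    have hm : Measurable fun i => relaxedProj α (C i) z :=
      (((hmeas z).sub_const z).const_smul α).const_add z
    have hite : Measurable fun i => if i ∈ G then relaxedProj α (C i) z else z :=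
      hm.ite hG measurable_const
    exact hite.comp (measurable_pi_apply 0)
  dist_le ω x y := by
    split_ifs
    · exact dist_relaxedProj_le (hne _) (hcl _) (hcv _) hα x y
    · exact le_rfl
  fix ω p hp := by
    split_ifs with h
    · exact relaxedProj_of_mem (hne _) (hcl _) α (hGC _ h hp)
    · rfl
  strict ω p hp z hz := by
    split_ifs at hz ⊢ with h
    · exact relaxedProj_of_mem (hne _) (hcl _) α
        (mem_of_dist_le_dist_relaxedProj (hne _) (hcl _) (hcv _) hα (hGC _ h hp) hz)
    · rfl
  mem_of_ae z hz := by
    have hm : Measurable fun i => relaxedProj α (C i) z :=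
      (((hmeas z).sub_const z).const_smul α).const_add z
    have h1 : ∀ᵐ i ∂ν, (if i ∈ G then relaxedProj α (C i) z else z) = z := by
      rw [← hμ]
      refine (ae_map_iff (measurable_pi_apply 0).aemeasurable ?_).2 hz
      exact measurableSet_eq_fun (hm.ite hG measurable_const) measurable_const
    have h2 : ∀ᵐ i ∂ν, z ∈ C i := by
      filter_upwards [h1, hGν] with i hi hiG
      rw [if_pos hiG] at hi
      exact (relaxedProj_eq_self_iff (hne i) (hcl i) hα.1.ne').1 hi
    exact h2
  isClosed := isClosed_aeInter hcl
  nonempty := hstar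

theorem iterate_shift_apply {I : Type*} (n m : ℕ) (ω : ℕ → I) :
    (fun (ω : ℕ → I) (n : ℕ) => ω (n + 1))^[n] ω m = ω (m + n) := by
  induction n generalizing ω with
  | zero => rfl
  | succ n ih => rw [Function.iterate_succ_apply, ih, add_assoc]

theorem mainTheorem4 {k : ℕ} {I W : Type*} [MeasurableSpace I] [MeasurableSpace W]
    (ν : Measure I) [IsProbabilityMeasure ν]
    (C : I → Set (EuclideanSpace ℝ (Fin k)))
    (hC_nonempty : ∀ i, (C i).Nonempty)
    (hC_closed : ∀ i, IsClosed (C i))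
    (hC_convex : ∀ i, Convex ℝ (C i))
    (hC_meas : ∀ x, Measurable fun i => metricProj (C i) x)
    (hCstar : (aeInter ν C).Nonempty)
    (α : ℝ) (hα : α ∈ Set.Ioo (0 : ℝ) 2)
    (P : Measure W) [IsProbabilityMeasure P]
    (ξ : ℕ → W → I) (hξ : IsErgodicStationary P ξ) (hξ_law : ∀ n, P.map (ξ n) = ν)
    (x₀ : EuclideanSpace ℝ (Fin k)) :
    (∀ n, Measurable (randProjIter C α ξ x₀ n)) ∧
      ∃ X : W → EuclideanSpace ℝ (Fin k),
        Measurable X ∧ (∀ w, X w ∈ aeInter ν C) ∧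
          ∀ᵐ w ∂P, Tendsto (fun n => randProjIter C α ξ x₀ n w) atTop (𝓝 (X w)) := by
  classical
  have hmX := measurable_randProjIter hC_nonempty hC_closed hC_convex hC_meas hα hξ.measurable x₀
  refine ⟨hmX, ?_⟩
  -- `IsFejerFamily` asks for `fix` and `strict` at every path, so the maps are modified off a
  -- measurable set of full measure.
  obtain ⟨G, hGν, hG, hGC⟩ := (ae_aeInter_subset (ν := ν) hC_closed).exists_measurable_mem
  have hpath : Measurable fun (w : W) (n : ℕ) => ξ n w := measurable_pi_lambda _ hξ.measurable
  have : IsProbabilityMeasure (P.map fun (w : W) (n : ℕ) => ξ n w) :=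
    Measure.isProbabilityMeasure_map hpath.aemeasurable
  have hlaw : (P.map fun (w : W) (n : ℕ) => ξ n w).map (fun ω => ω 0) = ν := by
    rw [Measure.map_map (measurable_pi_apply 0) hpath]
    exact hξ_law 0
  have hconv := ae_of_ae_map hpath.aemeasurable ((isFejerFamily_relaxedProj hC_nonempty hC_closed
    hC_convex hC_meas hCstar hα hlaw hG hGν hGC).ae_exists_tendsto hξ.ergodic x₀)
  -- Almost surely the modification is never felt, so the cocycle is the original iteration.
  have hgood : ∀ᵐ w ∂P, ∀ n, ξ n w ∈ G := ae_all_iff.2 fun n =>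
    ae_of_ae_map (hξ.measurable n).aemeasurable (by rw [hξ_law n]; exact hGν)
  have hlim : ∀ᵐ w ∂P, ∃ x ∈ aeInter ν C,
      Tendsto (fun n => randProjIter C α ξ x₀ n w) atTop (𝓝 x) := by
    filter_upwards [hconv, hgood] with w hw hwG
    convert hw using 5 with x n
    induction n with
    | zero => rfl
    | succ n ih =>
      rw [cocycleIter, ← ih, iterate_shift_apply, zero_add, if_pos (hwG n)]
      rfl
  obtain ⟨Y, hY, hYlim⟩ := measurable_limit_of_tendsto_metrizable_ae
    (fun n => (hmX n).aemeasurable) (hlim.mono fun w ⟨x, _, hx⟩ => ⟨x, hx⟩)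
  obtain ⟨p, hp⟩ := hCstar
  -- The limit lies in `C*` only almost surely; the default `p` makes this hold everywhere.
  refine ⟨fun w => if Y w ∈ aeInter ν C then Y w else p,
    hY.ite (hY (isClosed_aeInter hC_closed).measurableSet) measurable_const, fun w => ?_, ?_⟩
  · dsimp only
    split_ifs with h
    exacts [h, hp]
  · filter_upwards [hlim, hYlim] with w ⟨x, hxS, hx⟩ hYw
    rwa [if_pos (tendsto_nhds_unique hx hYw ▸ hxS)]
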